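/- Write $\mathcal B=\{0,1\}$, let $\mathcal B^*$ and $\mathcal B^\infty$ be the sets of finite and of infinite binary strings, $\ell(x)$ the length of $x$, $\epsilon$ the empty string, $x\sqsubseteq y$ for "$x$ is a prefix of $y$", and $\omega_{<n}=\omega_1\cdots\omega_{n-1}$. A *monotone machine* is a recursively enumerable set $L\subseteq\mathcal B^*\times\mathcal B^*$ such that for all $(p,y),(q,x)\in L$ with $p\sqsubseteq q$, one of $x,y$ is a prefix of the other. For a program $p$ let $L(p)$ be the set of all $y$ such that $y\sqsubseteq x$ for some $(p,x)\in L$, while there is no $(q,z)\in L$ with $q$ a proper prefix of $p$ and $y\sqsubseteq z$. Put $\mathbf M_L(y)=\sum_{p\,:\,y\in L(p)}2^{-\ell(p)}$. Let $L^0,L^1,L^2,\dots$ be a recursive enumeration (uniformly recursively enumerable, possibly with repetitions) of all monotone machines, let $i\mapsto i'$ be a computable prefix coding of the natural numbers (no code word is a prefix of another), let the universal monotone machine be $U=\{(i'p,y) : i\in\mathbb N,\ (p,y)\in L^i\}$, and put $\mathbf M=\mathbf M_U$ and $\mathbf M(b\mid x)=\mathbf M(xb)/\mathbf M(x)$ for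 $b \in \mathcal B$, $x\in\mathcal B^*$. **Theorem.** Let $f:\mathcal B^*\to\mathcal B\cup\{\epsilon\}$ be the total recursive function with $f(z)=z_{\ell(z)}$ if $\ell(z)$ is odd and $f(z)=\epsilon$ otherwise. For every choice of the enumeration $(L^i)$ and of the prefix coding $i\mapsto i'$ there exists an infinite string $\omega\in\mathcal B^\infty$ with $\omega_{2n}=f(\omega_{<2n})=\omega_{2n-1}$ for all $n\ge 1$ such that $$\liminf_{n\to\infty}\mathbf M(\omega_{2n}\mid\omega_{<2n})<1 .$$ -/

import Mathlib

open Filter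
open scoped ENNReal

namespace SolomonoffInduction

/-- A pair `(p, y)` of finite binary strings: a program and an output produced on it. -/
abbrev ProgOut : Type := List Bool × List Bool

/-- A monotone machine: a recursively enumerable set of program/output pairs such that, whenever
one program is a prefix of another, the corresponding outputs are comparable (the shorter output
is a prefix of the longer one). -/
structure IsMonotoneMachine (L : Set ProgOut) : Prop where
  re : REPred fun a : ProgOut => a ∈ L
  compat : ∀ p y q x, (p, y) ∈ L → (q, x) ∈ L → p <+: q → y <+: x ∨ x <+: y

/-- `L(p)`, the set of strings output by the program `p` on the monotone machine `L`: the string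
`y` belongs to `L(p)` if it is a prefix of some `x` with `(p, x) ∈ L` and no proper prefix `q`
of `p` already outputs an extension of `y`. -/
def output (L : Set ProgOut) (p : List Bool) : Set (List Bool) :=
  {y | (∃ x, (p, x) ∈ L ∧ y <+: x) ∧ ¬ ∃ q z, (q, z) ∈ L ∧ q <+: p ∧ q ≠ p ∧ y <+: z}

/-- `M_L(y) = ∑_{p : y ∈ L(p)} 2^{-ℓ(p)}`. -/
noncomputable def semimeasureOf (L : Set ProgOut) (y : List Bool) : ℝ≥0∞ :=
  ∑' p : {p : List Bool // y ∈ output L p}, (2⁻¹ : ℝ≥0∞) ^ p.1.length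

/-- The conditional `μ(b | x) = μ(xb) / μ(x)`. -/
noncomputable def condProb (μ : List Bool → ℝ≥0∞) (b : Bool) (x : List Bool) : ℝ≥0∞ :=
  μ (x ++ [b]) / μ x

/-- The data from which a reference universal monotone machine is built: a recursive enumeration
`machine 0, machine 1, …` (repetitions allowed) of all monotone machines, together with a computable
prefix coding `code` of the natural numbers. -/
structure MachineEnumeration where
  machine : ℕ → Set ProgOut
  isMonotone : ∀ i, IsMonotoneMachine (machine i)
  uniformly_re : REPred fun a : ℕ × ProgOut => a.2 ∈ machine a.1
  complete : ∀ L, IsMonotoneMachine L → ∃ i, machine i = L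
  code : ℕ → List Bool
  computable_code : Computable code
  prefixFree_code : ∀ i j, code i <+: code j → i = j

/-- The universal monotone machine `U`: `(i' p, y) ∈ U` iff `(p, y)` belongs to the `i`-th
monotone machine, where `i'` is the code word of `i`. -/
def MachineEnumeration.universal (E : MachineEnumeration) : Set ProgOut :=
  {a | ∃ i p, a.1 = E.code i ++ p ∧ (p, a.2) ∈ E.machine i}

/-- The universal a priori semimeasure `M`. -/
noncomputable def MachineEnumeration.M (E : MachineEnumeration) : List Bool → ℝ≥0∞ :=
  semimeasureOf E.universal

/-- The string consisting of the first `n` bits of the infinite string `ω`, whose bits are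
`ω 0, ω 1, ω 2, …`. -/
def initSeg (ω : ℕ → Bool) (n : ℕ) : List Bool :=
  (List.range n).map ω

/-- The predictor that predicts the last bit of a string of odd length, and makes no prediction
(`none`) on strings of even length. -/
def copyLast (z : List Bool) : Option Bool :=
  if Odd z.length then z.getLast? else none

/-! Recursive enumerations of all monotone machines exist. -/

section Existence

open Nat.Partrec (Code)

theorem rePred_exists {α : Type*} [Primcodable α] {P : α → ℕ → Prop}
    (h : ComputablePred fun x : α × ℕ => P x.1 x.2) : REPred fun a => ∃ n, P a n := by
  classical
  have h1 : Partrec (fun x : α => Nat.rfind fun n => Part.some (decide (P x n))) :=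
    Partrec.rfind h.decide.partrec
  refine h1.dom_re.of_eq fun a => ?_
  exact Nat.rfind_dom'.trans (by simp)

/-- If the first program is a prefix of the second, then the outputs are comparable (as a
truth value). -/
def okPair (a b : ProgOut) : Bool :=
  !(decide (b.1.take a.1.length = a.1)) ||
    (decide (b.2.take a.2.length = a.2) || decide (a.2.take b.2.length = b.2))

theorem okPair_iff (a b : ProgOut) :
    okPair a b = true ↔ (a.1 <+: b.1 → a.2 <+: b.2 ∨ b.2 <+: a.2) := by
  simp only [okPair, Bool.or_eq_true, Bool.not_eq_true', decide_eq_false_iff_not,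
    decide_eq_true_eq, List.prefix_iff_eq_take, eq_comm (a := List.take _ _)]
  tauto

theorem primrec_prefix : Primrec₂ fun x y : List Bool => decide (y.take x.length = x) :=
  PrimrecPred.decide
    (Primrec.eq.comp (Primrec.list_take.comp (Primrec.list_length.comp Primrec.fst) Primrec.snd)
      Primrec.fst)

theorem primrec_okPair : Primrec₂ okPair := by
  have h1 : Primrec₂ fun a b : ProgOut => decide (b.1.take a.1.length = a.1) :=
    primrec_prefix.comp (Primrec.fst.comp Primrec.fst) (Primrec.fst.comp Primrec.snd)
  have h2 : Primrec₂ fun a b : ProgOut => decide (b.2.take a.2.length = a.2) :=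
    primrec_prefix.comp (Primrec.snd.comp Primrec.fst) (Primrec.snd.comp Primrec.snd)
  have h3 : Primrec₂ fun a b : ProgOut => decide (a.2.take b.2.length = b.2) :=
    primrec_prefix.comp (Primrec.snd.comp Primrec.snd) (Primrec.snd.comp Primrec.fst)
  exact Primrec.or.comp (Primrec.not.comp h1) (Primrec.or.comp h2 h3)

/-- The `e`-th partial recursive function halts on `n` within `s` steps. -/
def hit (e s n : ℕ) : Bool :=
  (Code.evaln s (Denumerable.ofNat Code e) n).isSome

theorem primrec_hit : Primrec fun x : (ℕ × ℕ) × ℕ => hit x.1.1 x.1.2 x.2 :=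
  Primrec.option_isSome.comp (Code.primrec_evaln.comp
    (((Primrec.snd.comp Primrec.fst).pair
      ((Primrec.ofNat Code).comp (Primrec.fst.comp Primrec.fst))).pair Primrec.snd))

theorem hit_mono {e s t n : ℕ} (hst : s ≤ t) (h : hit e s n = true) : hit e t n = true := by
  obtain ⟨x, hx⟩ := Option.isSome_iff_exists.1 h
  exact Option.isSome_iff_exists.2 ⟨x, Code.evaln_mono hst hx⟩

theorem hit_lt {e s n : ℕ} (h : hit e s n = true) : n < s := by
  obtain ⟨x, hx⟩ := Option.isSome_iff_exists.1 h
  exact Code.evaln_bound hx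

/-- The two pairs coded by `k`, if both have been enumerated by stage `s`, are consistent. -/
def okAt (e s k : ℕ) : Bool :=
  !(hit e s k.unpair.1) || (!(hit e s k.unpair.2) ||
    ((Encodable.decode (α := ProgOut) k.unpair.1).bind fun a =>
      (Encodable.decode (α := ProgOut) k.unpair.2).map fun b => okPair a b).getD true)

theorem primrec_okAt : Primrec₂ fun (k : ℕ) (x : ℕ × ℕ) => okAt x.1 x.2 k := by
  have hu1 : Primrec fun y : ℕ × ℕ × ℕ => y.1.unpair.1 :=
    Primrec.fst.comp (Primrec.unpair.comp Primrec.fst)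
  have hu2 : Primrec fun y : ℕ × ℕ × ℕ => y.1.unpair.2 :=
    Primrec.snd.comp (Primrec.unpair.comp Primrec.fst)
  have h1 : Primrec fun y : ℕ × ℕ × ℕ => hit y.2.1 y.2.2 y.1.unpair.1 :=
    primrec_hit.comp (Primrec.snd.pair hu1)
  have h2 : Primrec fun y : ℕ × ℕ × ℕ => hit y.2.1 y.2.2 y.1.unpair.2 :=
    primrec_hit.comp (Primrec.snd.pair hu2)
  have h3 : Primrec fun y : ℕ × ℕ × ℕ =>
      ((Encodable.decode (α := ProgOut) y.1.unpair.1).bind fun a =>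
        (Encodable.decode (α := ProgOut) y.1.unpair.2).map fun b => okPair a b).getD true := by
    refine Primrec.option_getD.comp (Primrec.option_bind (Primrec.decode.comp hu1) ?_)
      (Primrec.const true)
    refine Primrec.option_map (Primrec.decode.comp (hu2.comp Primrec.fst)) ?_
    exact primrec_okPair.comp (Primrec.snd.comp Primrec.fst) Primrec.snd
  exact Primrec.or.comp (Primrec.not.comp h1) (Primrec.or.comp (Primrec.not.comp h2) h3)

theorem okAt_pair {e s : ℕ} {a b : ProgOut}
    (h : okAt e s (Nat.pair (Encodable.encode a) (Encodable.encode b)) = true)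
    (ha : hit e s (Encodable.encode a) = true) (hb : hit e s (Encodable.encode b) = true) :
    okPair a b = true := by
  simpa [okAt, ha, hb] using h

/-- The pairs enumerated by stage `s` are consistent. -/
def goodStage (e s : ℕ) : Prop :=
  ∀ k < s * s, okAt e s k = true

/-- The part of the `e`-th recursively enumerable set enumerated as long as it is consistent. -/
def stdMachine (e : ℕ) : Set ProgOut :=
  {a | ∃ s, goodStage e s ∧ hit e s (Encodable.encode a) = true}

theorem stdMachine_re : REPred fun a : ℕ × ProgOut => a.2 ∈ stdMachine a.1 := by
  have hgood : PrimrecPred fun y : (ℕ × ProgOut) × ℕ => goodStage y.1.1 y.2 := by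
    have hR : PrimrecRel fun (k : ℕ) (x : ℕ × ℕ) => okAt x.1 x.2 k = true :=
      Primrec.eq.comp primrec_okAt (Primrec.const true)
    exact (hR.forall_mem_list.comp
      (Primrec.list_range.comp (Primrec.nat_mul.comp Primrec.snd Primrec.snd))
      ((Primrec.fst.comp (Primrec.fst (α := ℕ × ProgOut) (β := ℕ))).pair Primrec.snd)).of_eq
        fun y => by simp [goodStage]
  have hhit : PrimrecPred fun y : (ℕ × ProgOut) × ℕ =>
      hit y.1.1 y.2 (Encodable.encode y.1.2) = true :=
    Primrec.eq.comp (primrec_hit.comp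
      (((Primrec.fst.comp Primrec.fst).pair Primrec.snd).pair
        (Primrec.encode.comp (Primrec.snd.comp Primrec.fst)))) (Primrec.const true)
  exact rePred_exists (P := fun (a : ℕ × ProgOut) s =>
    goodStage a.1 s ∧ hit a.1 s (Encodable.encode a.2) = true)
    (hgood.and hhit).computablePred

theorem stdMachine_isMonotone (e : ℕ) : IsMonotoneMachine (stdMachine e) where
  re := Partrec.comp (f := fun a : ℕ × ProgOut =>
      Part.assert (a.2 ∈ stdMachine a.1) fun _ => Part.some ())
    stdMachine_re ((Computable.const e).pair Computable.id)
  compat := by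
    rintro p y q x ⟨s, hs, h1⟩ ⟨t, ht, h2⟩ hpq
    have key : ∀ r, goodStage e r → hit e r (Encodable.encode (p, y)) = true →
        hit e r (Encodable.encode (q, x)) = true → y <+: x ∨ x <+: y := by
      intro r hr ha hb
      have hlt : Nat.pair (Encodable.encode (p, y)) (Encodable.encode (q, x)) < r * r := by
        have h3 := Nat.pair_lt_max_add_one_sq (Encodable.encode (p, y)) (Encodable.encode (q, x))
        have h4 : max (Encodable.encode (p, y)) (Encodable.encode (q, x)) + 1 ≤ r :=
          max_lt (hit_lt ha) (hit_lt hb)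
        exact h3.trans_le (by rw [sq]; exact Nat.mul_le_mul h4 h4)
      exact (okPair_iff _ _).1 (okAt_pair (hr _ hlt) ha hb) hpq
    rcases le_total s t with h | h
    · exact key t ht (hit_mono h h1) h2
    · exact key s hs h1 (hit_mono h h2)

theorem stdMachine_complete (L : Set ProgOut) (hL : IsMonotoneMachine L) :
    ∃ e, stdMachine e = L := by
  obtain ⟨c, hc⟩ := Code.exists_code.1 hL.re
  have hmem : ∀ a : ProgOut, a ∈ L ↔ ∃ s, hit (Encodable.encode c) s (Encodable.encode a) = true := by
    intro a
    have h1 : (Code.eval c (Encodable.encode a)).Dom ↔ a ∈ L := by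
      rw [hc]
      simp [Part.assert]
    rw [← h1, Part.dom_iff_mem]
    simp only [hit, Denumerable.ofNat_encode, Option.isSome_iff_exists, Code.evaln_complete,
      Option.mem_def]
    exact exists_comm
  refine ⟨Encodable.encode c, Set.ext fun a => ?_⟩
  rw [hmem]
  refine ⟨fun ⟨s, _, h⟩ => ⟨s, h⟩, fun ⟨s, h⟩ => ⟨s, fun k _ => ?_, h⟩⟩
  simp only [okAt, Bool.or_eq_true, Bool.not_eq_true']
  by_cases h1 : hit (Encodable.encode c) s k.unpair.1 = true
  swap
  · exact Or.inl (by simpa using h1)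
  by_cases h2 : hit (Encodable.encode c) s k.unpair.2 = true
  swap
  · exact Or.inr (Or.inl (by simpa using h2))
  refine Or.inr (Or.inr ?_)
  rcases hn : Encodable.decode (α := ProgOut) k.unpair.1 with _ | a
  · simp
  rcases hm : Encodable.decode (α := ProgOut) k.unpair.2 with _ | b
  · simp
  have mem : ∀ (n : ℕ) (a : ProgOut), Encodable.decode (α := ProgOut) n = some a →
      hit (Encodable.encode c) s n = true → a ∈ L := by
    intro n a hna hit1
    simp only [hit, Denumerable.ofNat_encode, Option.isSome_iff_exists] at hit1
    obtain ⟨x, hx⟩ := hit1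
    have h5 := Code.evaln_sound hx
    rw [hc] at h5
    simp only [hna] at h5
    simp [Part.assert] at h5
    exact h5.1
  simp only [Option.bind_some, Option.map_some, Option.getD_some]
  exact (okPair_iff a b).2 (hL.compat _ _ _ _ (mem _ _ hn h1) (mem _ _ hm h2))

/-- Recursive enumerations of all monotone machines, with a prefix coding of their indices, exist. -/
theorem nonempty_machineEnumeration : Nonempty MachineEnumeration :=
  ⟨{ machine := stdMachine
     isMonotone := stdMachine_isMonotone
     uniformly_re := stdMachine_re
     complete := stdMachine_complete
     code := fun i => (List.range i).map (fun _ => true) ++ [false]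
     computable_code := (Primrec.list_append.comp
       (Primrec.list_map Primrec.list_range (Primrec.const true).to₂)
       (Primrec.const [false])).to_comp
     prefixFree_code := by
       intro i j h
       have : ∀ i j : ℕ, List.replicate i true ++ [false] <+: List.replicate j true ++ [false] →
           i = j := by
         intro i
         induction i with
         | zero =>
           rintro (_ | j) h
           · rfl
           · simp [List.replicate_succ] at h
         | succ i ih =>
           rintro (_ | j) h
           · simp [List.replicate_succ] at h
           · simp only [List.replicate_succ, List.cons_append, List.cons_prefix_cons, true_and] at h
             rw [ih j h]
       apply this
       simpa using h }⟩

end Existence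

end SolomonoffInduction

/-!
The universal semimeasure `M = E.M` is made to lose a fixed fraction of its mass, infinitely often
along one string, at positions where the prediction is forced. It is defeated by a machine that
knows `M` through its lower approximations and that holds back part of its programs at such a
position until `M` has committed enough mass to a branch that those programs need not follow.

A program `d` is made to output `blocks d`, in which every bit `c` of `d` becomes `0 0 c c`. After
the first `0` of a block the next bit is forced, while `c` is still undecided. The demand at `d` is
`E.Met d`, that is `M (blocks d) + B d > 2 * 2 ^ (-ℓ(d))`, where `B` is the Bernoulli measure with
parameter `3 / 4`; it is recursively enumerable (`met_re`). The machine `adversary` lets the program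
`d 0` run freely, but releases `d 1` only once the demand at `d 0` is met. Until then the programs
extending `d 1` have output `blocks d` and one `0`, and nothing more.

Since `M` is superadditive and `B` is additive, a demand that is met at both children of `d` is met
at `d` (`met_of_met_children`); it is not met at the root, as `M ≤ 1` and `B = 1` there. So there is
an infinite path of released programs whose demands are never met: take `0` if the demand at the
child `d 0` is not met, and `1` otherwise. The path cannot end in ones only, because `B d` would then
exceed `2 * 2 ^ (-ℓ(d))` on its own (`exists_pathBit_eq_false`). This is what `B` is for: without it,
the path might never leave a released program waiting. Whenever the path takes `0`, the programs
extending `d 1` wait forever, so that `M` loses the mass `2 ^ (-ℓ(i') - ℓ(d) - 1)` at a forced bit,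
where `i'` is the code word of the adversary (`M_add_pow_le`). As the demand at `d` is not met, the
mass present there is at most `2 * 2 ^ (-ℓ(d))`, and the conditional probability of the forced bit
is at most `1 - 2 ^ (-ℓ(i') - 2)` (`condProb_le_of_pathBit_eq_false`). No self-reference is needed:
the demands do not involve `ℓ(i')`.

The estimates rest on the identity `semimeasureOf_eq_coin`: `M_L(y)` is the probability that `L`,
fed with independent fair coin flips, outputs an extension of `y`.
-/

namespace SolomonoffInduction

/-! ### Recursively enumerable predicates -/

section RecursivelyEnumerable

variable {α β : Type*} [Primcodable α] [Primcodable β]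

/-- Kleene normal form: an r.e. predicate is witnessed by the stages of a primitive recursive,
monotone approximation. -/
theorem exists_stages {P : α → Prop} (h : REPred P) :
    ∃ R : α → ℕ → Bool, Primrec₂ R ∧ (∀ a s t, s ≤ t → R a s = true → R a t = true) ∧
      ∀ a, P a ↔ ∃ s, R a s = true := by
  obtain ⟨c, hc⟩ := Nat.Partrec.Code.exists_code.1 h
  refine ⟨fun a s => hit (Encodable.encode c) s (Encodable.encode a), ?_,
    fun a s t hst => hit_mono hst, fun a => ?_⟩
  · exact primrec_hit.comp (((Primrec.const _).pair Primrec.snd).pair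
      (Primrec.encode.comp Primrec.fst))
  · have h1 : (Nat.Partrec.Code.eval c (Encodable.encode a)).Dom ↔ P a := by
      rw [hc]
      simp [Part.assert]
    rw [← h1, Part.dom_iff_mem]
    simp only [hit, Denumerable.ofNat_encode, Option.isSome_iff_exists,
      Nat.Partrec.Code.evaln_complete, Option.mem_def]
    exact exists_comm

theorem rePred_of_stages {R : α → ℕ → Bool} (hR : Primrec₂ R) :
    REPred fun a => ∃ s, R a s = true :=
  rePred_exists (P := fun a s => R a s = true)
    (Primrec.eq.comp hR (Primrec.const true)).computablePred

theorem rePred_of_primrecPred {P : α → Prop} (h : PrimrecPred P) : REPred P :=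
  h.computablePred.to_re

theorem rePred_comp {P : β → Prop} (h : REPred P) {f : α → β} (hf : Computable f) :
    REPred fun a => P (f a) :=
  Partrec.comp (f := fun b => Part.assert (P b) fun _ => Part.some ()) h hf

theorem rePred_and {P Q : α → Prop} (hP : REPred P) (hQ : REPred Q) :
    REPred fun a => P a ∧ Q a := by
  obtain ⟨R, hR, mR, eR⟩ := exists_stages hP
  obtain ⟨S, hS, mS, eS⟩ := exists_stages hQ
  refine (rePred_of_stages (R := fun a s => R a s && S a s) (Primrec.and.comp hR hS)).of_eq
    fun a => ?_
  rw [eR, eS]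
  simp only [Bool.and_eq_true]
  constructor
  · rintro ⟨s, h1, h2⟩
    exact ⟨⟨s, h1⟩, s, h2⟩
  · rintro ⟨⟨s, h1⟩, t, h2⟩
    exact ⟨max s t, mR _ _ _ (le_max_left _ _) h1, mS _ _ _ (le_max_right _ _) h2⟩

theorem rePred_or {P Q : α → Prop} (hP : REPred P) (hQ : REPred Q) :
    REPred fun a => P a ∨ Q a := by
  obtain ⟨R, hR, -, eR⟩ := exists_stages hP
  obtain ⟨S, hS, -, eS⟩ := exists_stages hQ
  refine (rePred_of_stages (R := fun a s => R a s || S a s) (Primrec.or.comp hR hS)).of_eq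
    fun a => ?_
  rw [eR, eS, ← exists_or]
  simp only [Bool.or_eq_true]

theorem rePred_ex {P : α → β → Prop} (h : REPred fun x : α × β => P x.1 x.2) :
    REPred fun a => ∃ b, P a b := by
  obtain ⟨R, hR, -, eR⟩ := exists_stages h
  have hp : Primrec₂ fun (a : α) (n : ℕ) =>
      ((Encodable.decode (α := β) n.unpair.1).map fun b => R (a, b) n.unpair.2).getD false := by
    refine Primrec.option_getD.comp (Primrec.option_map
      (Primrec.decode.comp (Primrec.fst.comp (Primrec.unpair.comp Primrec.snd))) ?_)
      (Primrec.const false)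
    exact hR.comp ((Primrec.fst.comp Primrec.fst).pair Primrec.snd)
      (Primrec.snd.comp (Primrec.unpair.comp (Primrec.snd.comp Primrec.fst)))
  refine (rePred_of_stages hp).of_eq fun a => ?_
  simp only [eR (_, _)]
  constructor
  · rintro ⟨n, hn⟩
    rcases hd : Encodable.decode (α := β) n.unpair.1 with _ | b
    · simp [hd] at hn
    · exact ⟨b, n.unpair.2, by simpa [hd] using hn⟩
  · rintro ⟨b, s, hs⟩
    exact ⟨Nat.pair (Encodable.encode b) s, by simpa using hs⟩

/-- Recursive enumerability is preserved by quantification over the members of a finite list, since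
finitely many witnessing stages have a common upper bound. -/
theorem rePred_forall_mem {P : α → β → Prop} (h : REPred fun x : α × β => P x.1 x.2) :
    REPred fun x : α × List β => ∀ b ∈ x.2, P x.1 b := by
  obtain ⟨R, hR, mR, eR⟩ := exists_stages h
  have hp : PrimrecPred fun y : (α × List β) × ℕ => ∀ b ∈ y.1.2, R (y.1.1, b) y.2 = true := by
    have hrel : PrimrecRel fun (b : β) (z : α × ℕ) => R (z.1, b) z.2 = true :=
      Primrec.eq.comp (hR.comp ((Primrec.fst.comp Primrec.snd).pair Primrec.fst)
        (Primrec.snd.comp Primrec.snd)) (Primrec.const true)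
    exact hrel.forall_mem_list.comp (Primrec.snd.comp Primrec.fst)
      ((Primrec.fst.comp Primrec.fst).pair Primrec.snd)
  refine (rePred_exists (P := fun (x : α × List β) s => ∀ b ∈ x.2, R (x.1, b) s = true)
    hp.computablePred).of_eq fun x => ?_
  obtain ⟨a, l⟩ := x
  simp only [eR (_, _)]
  constructor
  · rintro ⟨s, hs⟩ b hb
    exact ⟨s, hs b hb⟩
  · intro hl
    induction l with
    | nil => exact ⟨0, by simp⟩
    | cons b l ih =>
      obtain ⟨s, hs⟩ := ih fun b hb => hl b (List.mem_cons_of_mem _ hb)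
      obtain ⟨t, ht⟩ := hl b List.mem_cons_self
      refine ⟨max s t, fun c hc => ?_⟩
      rcases List.mem_cons.1 hc with rfl | hc
      · exact mR _ _ _ (le_max_right _ _) ht
      · exact mR _ _ _ (le_max_left _ _) (hs c hc)

theorem primrecPred_prefix {f g : α → List β} (hf : Primrec f) (hg : Primrec g) :
    PrimrecPred fun a => f a <+: g a :=
  (Primrec.eq.comp hf (Primrec.list_take.comp (Primrec.list_length.comp hf) hg)).of_eq
    fun _ => List.prefix_iff_eq_take.symm

theorem primrecPred_nodup : PrimrecPred fun l : List β => l.Nodup := by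
  have h1 : PrimrecRel fun (i : ℕ) (y : ℕ × List β) => y.2[i]? ≠ y.2[y.1]? :=
    (Primrec.eq.comp (Primrec.list_getElem?.comp (Primrec.snd.comp Primrec.snd) Primrec.fst)
      (Primrec.list_getElem?.comp (Primrec.snd.comp Primrec.snd)
        (Primrec.fst.comp Primrec.snd))).not
  have h2 : PrimrecRel fun (j : ℕ) (l : List β) => ∀ i ∈ List.range j, l[i]? ≠ l[j]? :=
    h1.forall_mem_list.comp (Primrec.list_range.comp Primrec.fst) Primrec.id
  refine (h2.forall_mem_list.comp (Primrec.list_range.comp Primrec.list_length)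
    Primrec.id).of_eq fun l => ?_
  rw [List.nodup_iff_getElem?_ne_getElem?]
  simp only [List.mem_range]
  exact ⟨fun h i j hij hj => h j hj i hij, fun h j hj i hij => h i j hij hj⟩

theorem primrec_nat_pow : Primrec₂ fun b n : ℕ => b ^ n := by
  have h : Primrec fun y : ℕ × ℕ => (Nat.rec 1 (fun _ r => r * y.1) y.2 : ℕ) :=
    Primrec.nat_rec' Primrec.snd (Primrec.const 1)
      (Primrec.nat_mul.comp (Primrec.snd.comp Primrec.snd) (Primrec.fst.comp Primrec.fst)).to₂
  refine h.of_eq fun y => ?_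
  induction y.2 with
  | zero => simp
  | succ n ih => simp only [pow_succ, ← ih]

end RecursivelyEnumerable

/-! ### The predictor -/

theorem computable_copyLast : Computable copyLast := by
  have hodd : PrimrecPred fun z : List Bool => Odd z.length :=
    (Primrec.eq.comp (Primrec.nat_mod.comp Primrec.list_length (Primrec.const 2))
      (Primrec.const 1)).of_eq fun z => Nat.odd_iff.symm
  have hlast : Primrec fun z : List Bool => z.getLast? :=
    (Primrec.list_head?.comp Primrec.list_reverse).of_eq fun z => by simp
  exact (Primrec.ite hodd hlast (Primrec.const none)).to_comp

/-! ### Initial segments -/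

theorem length_initSeg (α : ℕ → Bool) (n : ℕ) : (initSeg α n).length = n := by
  simp [initSeg]

theorem initSeg_succ (α : ℕ → Bool) (n : ℕ) : initSeg α (n + 1) = initSeg α n ++ [α n] := by
  simp [initSeg, List.range_succ]

theorem initSeg_prefix (α : ℕ → Bool) {m n : ℕ} (h : m ≤ n) : initSeg α m <+: initSeg α n := by
  induction n, h using Nat.le_induction with
  | base => exact List.prefix_rfl
  | succ n _ ih => exact ih.trans (initSeg_succ α n ▸ List.prefix_append _ _)

theorem eq_initSeg_of_prefix {α : ℕ → Bool} {p : List Bool} {n : ℕ} (h : p <+: initSeg α n) :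
    initSeg α p.length = p := by
  have hn : p.length ≤ n := by simpa [length_initSeg] using h.length_le
  exact (List.prefix_of_prefix_length_le (initSeg_prefix α hn) h
    (by simp [length_initSeg])).eq_of_length (by simp [length_initSeg])

/-! ### The uniform measure on infinite strings -/

/-- The cylinder of all infinite strings that extend `p`. -/
def cyl (p : List Bool) : Set (ℕ → Bool) :=
  {α | initSeg α p.length = p}

/-- The distribution of a sequence of independent fair coin flips. -/
noncomputable def coin : MeasureTheory.Measure (ℕ → Bool) :=
  MeasureTheory.Measure.infinitePi fun _ => (PMF.uniformOfFintype Bool).toMeasure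

instance : MeasureTheory.IsProbabilityMeasure coin := by
  unfold coin
  infer_instance

theorem cyl_eq_pi (p : List Bool) :
    cyl p = Set.pi (Finset.range p.length) fun i => {p.getD i false} := by
  ext α
  simp only [cyl, Set.mem_ofPred_eq, Set.mem_pi, Finset.coe_range, Set.mem_Iio,
    Set.mem_singleton_iff]
  constructor
  · intro h i hi
    rw [← h]
    simp [initSeg, hi, List.getD_eq_getElem?_getD]
  · intro h
    refine List.ext_getElem (length_initSeg _ _) fun i h1 h2 => ?_
    simp [initSeg, h i h2, h2]

theorem measurableSet_cyl (p : List Bool) : MeasurableSet (cyl p) := by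
  rw [cyl_eq_pi]
  exact MeasurableSet.pi (Finset.countable_toSet _) fun i _ => measurableSet_singleton _

theorem coin_cyl (p : List Bool) : coin (cyl p) = 2⁻¹ ^ p.length := by
  rw [cyl_eq_pi, coin,
    MeasureTheory.Measure.infinitePi_pi _ fun i _ => measurableSet_singleton _]
  simp

theorem cyl_disjoint {p q : List Bool} (h : ¬ p <+: q) (h' : ¬ q <+: p) :
    Disjoint (cyl p) (cyl q) := by
  rw [Set.disjoint_left]
  intro α hp hq
  have hp' : initSeg α p.length = p := hp
  have hq' : initSeg α q.length = q := hq
  rcases le_total p.length q.length with hl | hl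
  · exact h (hp' ▸ hq' ▸ by simpa [length_initSeg] using initSeg_prefix α hl)
  · exact h' (hp' ▸ hq' ▸ by simpa [length_initSeg] using initSeg_prefix α hl)

/-! ### The semimeasure of a machine as a probability -/

/-- The event that the machine `L`, reading an infinite string as its input, outputs an extension
of `y`. -/
def outputEvent (L : Set ProgOut) (y : List Bool) : Set (ℕ → Bool) :=
  {α | ∃ n x, (initSeg α n, x) ∈ L ∧ y <+: x}

theorem outputEvent_anti (L : Set ProgOut) {y z : List Bool} (h : y <+: z) :
    outputEvent L z ⊆ outputEvent L y :=
  fun _ ⟨n, x, hx, hz⟩ => ⟨n, x, hx, h.trans hz⟩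

theorem outputEvent_disjoint {L : Set ProgOut}
    (hL : ∀ p y q x, (p, y) ∈ L → (q, x) ∈ L → p <+: q → y <+: x ∨ x <+: y)
    {y z : List Bool} (h : ¬ y <+: z) (h' : ¬ z <+: y) :
    Disjoint (outputEvent L y) (outputEvent L z) := by
  have key : ∀ u v : List Bool, y <+: u → z <+: v → ¬ (u <+: v ∨ v <+: u) := by
    rintro u v hu hv (huv | huv)
    · exact (List.prefix_or_prefix_of_prefix (hu.trans huv) hv).elim h h'
    · exact (List.prefix_or_prefix_of_prefix hu (hv.trans huv)).elim h h'
  rw [Set.disjoint_left]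
  rintro α ⟨m, u, hu, hyu⟩ ⟨n, v, hv, hzv⟩
  rcases le_total m n with hmn | hmn
  · exact key u v hyu hzv (hL _ _ _ _ hu hv (initSeg_prefix α hmn))
  · exact key u v hyu hzv (hL _ _ _ _ hv hu (initSeg_prefix α hmn)).symm

/-- An infinite input producing an extension of `y` has exactly one initial segment in
`{p | y ∈ output L p}`, namely the shortest one that produces an extension of `y`. -/
theorem outputEvent_eq_iUnion (L : Set ProgOut) (y : List Bool) :
    outputEvent L y = ⋃ p : {p : List Bool // y ∈ output L p}, cyl p.1 := by
  classical
  ext α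
  simp only [Set.mem_iUnion]
  constructor
  · intro h
    have h0 : ∃ n, ∃ x, (initSeg α n, x) ∈ L ∧ y <+: x := h
    refine ⟨⟨initSeg α (Nat.find h0), Nat.find_spec h0, ?_⟩, ?_⟩
    · rintro ⟨q, z, hq, hqp, hne, hyz⟩
      have hq' := eq_initSeg_of_prefix hqp
      have hlt : q.length < Nat.find h0 := by
        refine lt_of_le_of_ne (by simpa [length_initSeg] using hqp.length_le) fun he => hne ?_
        rw [← hq', he]
      exact Nat.find_min h0 hlt ⟨z, by rwa [hq'], hyz⟩
    · simp [cyl, length_initSeg]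
  · rintro ⟨⟨p, ⟨x, hx, hyx⟩, _⟩, hp⟩
    have hp' : initSeg α p.length = p := hp
    exact ⟨p.length, x, by rwa [hp'], hyx⟩

theorem measurableSet_outputEvent (L : Set ProgOut) (y : List Bool) :
    MeasurableSet (outputEvent L y) := by
  rw [outputEvent_eq_iUnion]
  exact MeasurableSet.iUnion fun p => measurableSet_cyl _

theorem semimeasureOf_eq_coin (L : Set ProgOut) (y : List Bool) :
    semimeasureOf L y = coin (outputEvent L y) := by
  rw [outputEvent_eq_iUnion, MeasureTheory.measure_iUnion _ fun p => measurableSet_cyl _]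
  · simp only [semimeasureOf, coin_cyl]
  · rintro ⟨p, ⟨x, hx, hyx⟩, hp⟩ ⟨q, ⟨z, hz, hyz⟩, hq⟩ hne
    have hpq : p ≠ q := fun h => hne (Subtype.ext h)
    exact cyl_disjoint (fun h => hq ⟨p, x, hx, h, hpq, hyx⟩)
      fun h => hp ⟨q, z, hz, h, hpq.symm, hyz⟩

theorem coin_biUnion_cyl {N : ℕ} (S : Finset (List Bool)) (hS : ∀ w ∈ S, w.length = N) :
    coin (⋃ w ∈ S, cyl w) = S.card * 2⁻¹ ^ N := by
  rw [MeasureTheory.measure_biUnion_finset _ fun w _ => measurableSet_cyl w]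
  · rw [Finset.sum_congr rfl fun w hw => by rw [coin_cyl, hS w hw]]
    simp
  · intro v hv w hw hne
    have hl : v.length = w.length := (hS v hv).trans (hS w hw).symm
    exact cyl_disjoint (fun h => hne (h.eq_of_length hl)) fun h => hne (h.eq_of_length hl.symm).symm

/-- Lower approximation of `M_L(y)`: a lower bound on `M_L(y)` is certified by finitely many
input strings of a common length on which `L` outputs an extension of `y`. -/
theorem lt_semimeasureOf_iff (L : Set ProgOut) (y : List Bool) (r : ℝ≥0∞) :
    r < semimeasureOf L y ↔ ∃ (N : ℕ) (S : List (List Bool)), S.Nodup ∧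
      (∀ w ∈ S, w.length = N ∧ ∃ q x, (q, x) ∈ L ∧ q <+: w ∧ y <+: x) ∧
      r < S.length * 2⁻¹ ^ N := by
  classical
  rw [semimeasureOf_eq_coin]
  constructor
  · intro h
    let G : ℕ → Set (ℕ → Bool) := fun N => {α | ∃ n ≤ N, ∃ x, (initSeg α n, x) ∈ L ∧ y <+: x}
    have hG : outputEvent L y = ⋃ N, G N := by
      ext α
      simp only [outputEvent, G, Set.mem_ofPred_eq, Set.mem_iUnion]
      exact ⟨fun ⟨n, hn⟩ => ⟨n, n, le_rfl, hn⟩, fun ⟨_, n, _, hn⟩ => ⟨n, hn⟩⟩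
    have hmono : Monotone G := fun _ _ hmn _ ⟨n, hn, hx⟩ => ⟨n, hn.trans hmn, hx⟩
    rw [hG, hmono.measure_iUnion, lt_iSup_iff] at h
    obtain ⟨N, hN⟩ := h
    let W : Finset (List Bool) :=
      ((List.finite_length_eq Bool N).toFinset).filter
        fun w => ∃ q x, (q, x) ∈ L ∧ q <+: w ∧ y <+: x
    have hW : ∀ w ∈ W, w.length = N ∧ ∃ q x, (q, x) ∈ L ∧ q <+: w ∧ y <+: x := by
      intro w hw
      simpa [W] using hw
    refine ⟨N, W.toList, W.nodup_toList, fun w hw => hW w (by simpa using hw),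
      hN.trans_le ?_⟩
    rw [Finset.length_toList, ← coin_biUnion_cyl W fun w hw => (hW w hw).1]
    refine MeasureTheory.measure_mono fun α => ?_
    rintro ⟨n, hn, x, hx, hyx⟩
    refine Set.mem_iUnion₂.2 ⟨initSeg α N, ?_, by simp [cyl, length_initSeg]⟩
    simp only [W, Finset.mem_filter, Set.Finite.mem_toFinset, Set.mem_ofPred_eq, length_initSeg,
      true_and]
    exact ⟨_, x, hx, initSeg_prefix α hn, hyx⟩
  · rintro ⟨N, S, hnd, hS, hr⟩
    rw [← List.toFinset_card_of_nodup hnd,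
      ← coin_biUnion_cyl S.toFinset fun w hw => (hS w (by simpa using hw)).1] at hr
    refine hr.trans_le (MeasureTheory.measure_mono fun α hα => ?_)
    obtain ⟨w, hw, hαw⟩ := Set.mem_iUnion₂.1 hα
    obtain ⟨-, q, x, hq, hqw, hyx⟩ := hS w (by simpa using hw)
    have hα' : initSeg α w.length = w := hαw
    rw [← hα'] at hqw
    exact ⟨q.length, x, by rwa [eq_initSeg_of_prefix hqw], hyx⟩

theorem semimeasureOf_le_one (L : Set ProgOut) (y : List Bool) : semimeasureOf L y ≤ 1 :=
  semimeasureOf_eq_coin L y ▸ MeasureTheory.prob_le_one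

theorem semimeasureOf_anti (L : Set ProgOut) {y z : List Bool} (h : y <+: z) :
    semimeasureOf L z ≤ semimeasureOf L y := by
  simp only [semimeasureOf_eq_coin]
  exact MeasureTheory.measure_mono (outputEvent_anti L h)

theorem semimeasureOf_add_le {L : Set ProgOut}
    (hL : ∀ p y q x, (p, y) ∈ L → (q, x) ∈ L → p <+: q → y <+: x ∨ x <+: y)
    {y u v : List Bool} (hu : y <+: u) (hv : y <+: v) (h : ¬ u <+: v) (h' : ¬ v <+: u) :
    semimeasureOf L u + semimeasureOf L v ≤ semimeasureOf L y := by
  simp only [semimeasureOf_eq_coin]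
  rw [← MeasureTheory.measure_union (outputEvent_disjoint hL h h')
    (measurableSet_outputEvent L v)]
  exact MeasureTheory.measure_mono
    (Set.union_subset (outputEvent_anti L hu) (outputEvent_anti L hv))

/-- A program `p` that outputs an extension of `y` but, whatever is appended to it, no extension of
`z` contributes its full weight to the difference of the two semimeasures. -/
theorem semimeasureOf_add_pow_le {L : Set ProgOut} {y z p : List Bool} (hyz : y <+: z)
    (hy : ∃ q x, (q, x) ∈ L ∧ q <+: p ∧ y <+: x)
    (hz : ∀ q x, (q, x) ∈ L → (q <+: p ∨ p <+: q) → ¬ z <+: x) :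
    semimeasureOf L z + 2⁻¹ ^ p.length ≤ semimeasureOf L y := by
  simp only [semimeasureOf_eq_coin]
  have hdisj : Disjoint (outputEvent L z) (cyl p) := by
    rw [Set.disjoint_left]
    rintro α ⟨n, x, hx, hzx⟩ hα
    have hα' : initSeg α p.length = p := hα
    refine hz _ x hx ?_ hzx
    rw [← hα']
    exact (le_total n p.length).imp (initSeg_prefix α) (initSeg_prefix α)
  rw [← coin_cyl, ← MeasureTheory.measure_union hdisj (measurableSet_cyl p)]
  refine MeasureTheory.measure_mono (Set.union_subset (outputEvent_anti L hyz) fun α hα => ?_)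
  obtain ⟨q, x, hq, hqp, hyx⟩ := hy
  have hα' : initSeg α p.length = p := hα
  rw [← hα'] at hqp
  exact ⟨q.length, x, by rwa [eq_initSeg_of_prefix hqp], hyx⟩

/-! ### Certified lower bounds are recursively enumerable -/

/-- The certificates of `lt_semimeasureOf_iff`, with a constant added on the right; for `a < c` the
empty certificate suffices. -/
theorem lt_semimeasureOf_add_iff (L : Set ProgOut) (y : List Bool) {a c : ℝ≥0∞} (hc : c ≠ ⊤) :
    a < semimeasureOf L y + c ↔ ∃ (N : ℕ) (S : List (List Bool)), S.Nodup ∧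
      (∀ w ∈ S, w.length = N ∧ ∃ q x, (q, x) ∈ L ∧ q <+: w ∧ y <+: x) ∧
      a < S.length * 2⁻¹ ^ N + c := by
  constructor
  · intro h
    rcases lt_or_ge a c with hac | hca
    · exact ⟨0, [], List.nodup_nil, by simp, by simpa using hac⟩
    · have h1 : a - c < semimeasureOf L y :=
        (ENNReal.cancel_of_ne hc).tsub_lt_iff_right hca |>.2 h
      obtain ⟨N, S, hnd, hS, hr⟩ := (lt_semimeasureOf_iff L y _).1 h1
      exact ⟨N, S, hnd, hS, ((ENNReal.cancel_of_ne hc).tsub_lt_iff_right hca).1 hr⟩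
  · rintro ⟨N, S, hnd, hS, hr⟩
    refine hr.trans_le (add_le_add_left (le_of_forall_lt fun r hr' => ?_) c)
    exact (lt_semimeasureOf_iff L y r).2 ⟨N, S, hnd, hS, hr'⟩

/-- The certified inequality after multiplication by `4 ^ n * 2 ^ N`, as a decidable relation between
natural numbers. -/
theorem threshold_lt_iff (n N s b : ℕ) :
    (2 * 2⁻¹ ^ n : ℝ≥0∞) < s * 2⁻¹ ^ N + b * 4⁻¹ ^ n ↔
      2 * 2 ^ n * 2 ^ N < s * 4 ^ n + b * 2 ^ N := by
  have h1 : (2 * 2⁻¹ ^ n : ℝ≥0∞) = ((2 * 2⁻¹ ^ n : NNReal) : ℝ≥0∞) := by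
    push_cast [ENNReal.coe_inv]
    norm_num
  have h2 : (s * 2⁻¹ ^ N + b * 4⁻¹ ^ n : ℝ≥0∞) =
      ((s * 2⁻¹ ^ N + b * 4⁻¹ ^ n : NNReal) : ℝ≥0∞) := by
    push_cast [ENNReal.coe_inv]
    norm_num
  rw [h1, h2, ENNReal.coe_lt_coe, ← NNReal.coe_lt_coe,
    ← mul_lt_mul_iff_of_pos_right (show (0 : ℝ) < 4 ^ n * 2 ^ N by positivity),
    ← Nat.cast_lt (α := ℝ)]
  have h4 : (4 : ℝ) ^ n = 2 ^ n * 2 ^ n := by rw [← mul_pow]; norm_num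
  have e1 : ((2 * 2⁻¹ ^ n : NNReal) : ℝ) * (4 ^ n * 2 ^ N) = 2 * 2 ^ n * 2 ^ N := by
    push_cast
    rw [h4, inv_pow]
    field_simp
  have e2 : ((s * 2⁻¹ ^ N + b * 4⁻¹ ^ n : NNReal) : ℝ) * (4 ^ n * 2 ^ N) =
      s * 4 ^ n + b * 2 ^ N := by
    push_cast
    rw [inv_pow, inv_pow]
    field_simp
  rw [e1, e2]
  push_cast
  rfl

/-! ### The adversarial machine -/

/-- The output string belonging to a program: each bit `c` of the program is turned into the block
`0 0 c c`. After the first bit of a block the next one is forced, and a machine can wait there before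
it commits itself to `c`. -/
def blocks (d : List Bool) : List Bool :=
  d.flatMap fun c => [false, false, c, c]

/-- The numerator of the Bernoulli measure of the cylinder of `d`, each bit being `1` with
probability `3 / 4`; the denominator is `4 ^ d.length`. -/
def biasWeight (d : List Bool) : ℕ :=
  d.foldr (fun c r => (if c then 3 else 1) * r) 1

theorem blocks_append (d e : List Bool) : blocks (d ++ e) = blocks d ++ blocks e := by
  simp [blocks]

theorem length_blocks (d : List Bool) : (blocks d).length = 4 * d.length := by
  induction d with
  | nil => rfl
  | cons c d ih =>
    rw [← List.singleton_append, blocks_append, List.length_append, ih]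
    simp [blocks]
    ring

theorem blocks_concat_prefix {d e : List Bool} (h : d <+: e) :
    blocks d ++ [false] <+: blocks e ++ [false] := by
  obtain ⟨t, rfl⟩ := h
  rw [blocks_append, List.append_assoc, List.prefix_append_right_inj]
  cases t <;> simp [blocks]

theorem biasWeight_append (d e : List Bool) :
    biasWeight (d ++ e) = biasWeight d * biasWeight e := by
  induction d with
  | nil => simp [biasWeight]
  | cons c d ih =>
    simp only [biasWeight, List.cons_append, List.foldr_cons] at ih ⊢
    rw [ih, mul_assoc]

theorem primrec_blocks : Primrec blocks :=
  Primrec.list_flatMap Primrec.id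
    ((Primrec.dom_bool fun c => [false, false, c, c]).comp Primrec.snd).to₂

theorem primrec_biasWeight : Primrec biasWeight :=
  Primrec.list_foldr Primrec.id (Primrec.const 1)
    (Primrec.nat_mul.comp
      ((Primrec.dom_bool fun c => if c then 3 else 1).comp (Primrec.fst.comp Primrec.snd))
      (Primrec.snd.comp Primrec.snd)).to₂

namespace MachineEnumeration

variable (E : MachineEnumeration)

theorem universal_re : REPred fun a : ProgOut => a ∈ E.universal := by
  have hcode : Computable fun y : (ProgOut × ℕ) × List Bool => E.code y.1.2 ++ y.2 :=
    Computable.list_append.comp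
      (E.computable_code.comp (Computable.snd.comp Computable.fst)) Computable.snd
  have h1 : REPred fun y : (ProgOut × ℕ) × List Bool => y.1.1.1 = E.code y.1.2 ++ y.2 := by
    have hpair : Computable fun y : (ProgOut × ℕ) × List Bool =>
        (y.1.1.1, E.code y.1.2 ++ y.2) :=
      (Computable.fst.comp (Computable.fst.comp Computable.fst)).pair hcode
    have heq : REPred fun z : List Bool × List Bool => z.1 = z.2 :=
      rePred_of_primrecPred (Primrec.eq.comp Primrec.fst Primrec.snd)
    have h := rePred_comp heq hpair
    exact h
  have h2 : REPred fun y : (ProgOut × ℕ) × List Bool => (y.2, y.1.1.2) ∈ E.machine y.1.2 := by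
    have htriple : Computable fun y : (ProgOut × ℕ) × List Bool => (y.1.2, y.2, y.1.1.2) :=
      (Computable.snd.comp Computable.fst).pair
        (Computable.snd.pair (Computable.snd.comp (Computable.fst.comp Computable.fst)))
    have h := rePred_comp E.uniformly_re htriple
    exact h
  have h3 : REPred fun y : ProgOut × ℕ =>
      ∃ p, y.1.1 = E.code y.2 ++ p ∧ (p, y.1.2) ∈ E.machine y.2 :=
    rePred_ex (P := fun (y : ProgOut × ℕ) p =>
      y.1.1 = E.code y.2 ++ p ∧ (p, y.1.2) ∈ E.machine y.2) (rePred_and h1 h2)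
  exact (rePred_ex (P := fun (a : ProgOut) i =>
    ∃ p, a.1 = E.code i ++ p ∧ (p, a.2) ∈ E.machine i) h3).of_eq fun a => Iff.rfl

theorem universal_compat (p y q x : List Bool) (hp : (p, y) ∈ E.universal)
    (hq : (q, x) ∈ E.universal) (hpq : p <+: q) : y <+: x ∨ x <+: y := by
  obtain ⟨i, p, rfl, hp⟩ := hp
  obtain ⟨j, q, rfl, hq⟩ := hq
  have hij : i = j := by
    rcases List.prefix_or_prefix_of_prefix ((List.prefix_append _ p).trans hpq)
      (List.prefix_append _ q) with h | h
    · exact E.prefixFree_code _ _ h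
    · exact (E.prefixFree_code _ _ h).symm
  subst hij
  exact (E.isMonotone i).compat p y q x hp hq ((List.prefix_append_right_inj _).1 hpq)

/-- The demand at `d` is met: the universal semimeasure of `blocks d` exceeds
`2 * 2 ^ (-ℓ(d))` less the Bernoulli measure of `d`. -/
def Met (d : List Bool) : Prop :=
  (2 * 2⁻¹ ^ d.length : ℝ≥0∞) < E.M (blocks d) + biasWeight d * 4⁻¹ ^ d.length

/-- The program `d` is released: wherever it takes the bit `1`, the demand at the sibling with the
bit `0` is met. -/
def Released (d : List Bool) : Prop :=
  ∀ e, e ++ [true] <+: d → E.Met (e ++ [false])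

/-- The machine that outputs `blocks d` followed by `0` on each released program `d`. -/
def adversary : Set ProgOut :=
  {a | E.Released a.1 ∧ a.2 = blocks a.1 ++ [false]}

theorem met_re : REPred E.Met := by
  have hQ : REPred fun y : List Bool × List Bool =>
      ∃ a : ProgOut, a ∈ E.universal ∧ a.1 <+: y.2 ∧ y.1 <+: a.2 := by
    refine rePred_ex (P := fun (y : List Bool × List Bool) (a : ProgOut) =>
      a ∈ E.universal ∧ a.1 <+: y.2 ∧ y.1 <+: a.2) (rePred_and ?_ ?_)
    · exact rePred_comp E.universal_re Computable.snd
    · exact rePred_of_primrecPred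
        ((primrecPred_prefix (Primrec.fst.comp Primrec.snd) (Primrec.snd.comp Primrec.fst)).and
          (primrecPred_prefix (Primrec.fst.comp Primrec.fst) (Primrec.snd.comp Primrec.snd)))
  -- Certificates are quantified over as triples `((d, N), S)`.
  have h1 : REPred fun y : (List Bool × ℕ) × List (List Bool) => y.2.Nodup :=
    rePred_of_primrecPred (primrecPred_nodup.comp Primrec.snd)
  have h2 : REPred fun y : (List Bool × ℕ) × List (List Bool) =>
      ∀ w ∈ y.2, w.length = y.1.2 ∧
        ∃ a : ProgOut, a ∈ E.universal ∧ a.1 <+: w ∧ blocks y.1.1 <+: a.2 := by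
    refine rePred_forall_mem (P := fun (z : List Bool × ℕ) w => w.length = z.2 ∧
      ∃ a : ProgOut, a ∈ E.universal ∧ a.1 <+: w ∧ blocks z.1 <+: a.2) (rePred_and ?_ ?_)
    · exact rePred_of_primrecPred (Primrec.eq.comp (Primrec.list_length.comp Primrec.snd)
        (Primrec.snd.comp Primrec.fst))
    · exact rePred_comp hQ
        ((primrec_blocks.comp (Primrec.fst.comp Primrec.fst)).pair Primrec.snd).to_comp
  have h3 : REPred fun y : (List Bool × ℕ) × List (List Bool) =>
      2 * 2 ^ y.1.1.length * 2 ^ y.1.2 <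
        y.2.length * 4 ^ y.1.1.length + biasWeight y.1.1 * 2 ^ y.1.2 := by
    have hd : Primrec fun y : (List Bool × ℕ) × List (List Bool) => y.1.1 :=
      Primrec.fst.comp Primrec.fst
    have hl := Primrec.list_length.comp hd
    have hN : Primrec fun y : (List Bool × ℕ) × List (List Bool) => y.1.2 :=
      Primrec.snd.comp Primrec.fst
    have h2N := primrec_nat_pow.comp (Primrec.const 2) hN
    exact rePred_of_primrecPred (Primrec.nat_lt.comp
      (Primrec.nat_mul.comp (Primrec.nat_mul.comp (Primrec.const 2)
        (primrec_nat_pow.comp (Primrec.const 2) hl)) h2N)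
      (Primrec.nat_add.comp (Primrec.nat_mul.comp (Primrec.list_length.comp Primrec.snd)
        (primrec_nat_pow.comp (Primrec.const 4) hl))
        (Primrec.nat_mul.comp (primrec_biasWeight.comp hd) h2N)))
  have h4 : REPred fun z : List Bool × ℕ => ∃ S : List (List Bool), S.Nodup ∧
      (∀ w ∈ S, w.length = z.2 ∧
        ∃ a : ProgOut, a ∈ E.universal ∧ a.1 <+: w ∧ blocks z.1 <+: a.2) ∧
      2 * 2 ^ z.1.length * 2 ^ z.2 <
        S.length * 4 ^ z.1.length + biasWeight z.1 * 2 ^ z.2 :=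
    rePred_ex (rePred_and h1 (rePred_and h2 h3))
  refine (rePred_ex (P := fun (d : List Bool) (N : ℕ) => ∃ S : List (List Bool), S.Nodup ∧
      (∀ w ∈ S, w.length = N ∧
        ∃ a : ProgOut, a ∈ E.universal ∧ a.1 <+: w ∧ blocks d <+: a.2) ∧
      2 * 2 ^ d.length * 2 ^ N <
        S.length * 4 ^ d.length + biasWeight d * 2 ^ N) h4).of_eq fun d => ?_
  have hfin : (biasWeight d * 4⁻¹ ^ d.length : ℝ≥0∞) ≠ ⊤ :=
    ENNReal.mul_ne_top (ENNReal.natCast_ne_top _) (ENNReal.pow_ne_top (by simp))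
  rw [Met, M, lt_semimeasureOf_add_iff _ _ hfin]
  simp only [threshold_lt_iff, Prod.exists]

theorem released_re : REPred E.Released := by
  have h : REPred fun y : List Bool × ℕ =>
      ¬ y.1[y.2]? = some true ∨ E.Met (y.1.take y.2 ++ [false]) := by
    refine rePred_or (rePred_of_primrecPred
      (Primrec.eq.comp (Primrec.list_getElem?.comp Primrec.fst Primrec.snd)
        (Primrec.const (some true))).not) (rePred_comp E.met_re ?_)
    exact (Primrec.list_append.comp (Primrec.list_take.comp Primrec.snd Primrec.fst)
      (Primrec.const [false])).to_comp
  refine (rePred_comp (rePred_forall_mem (P := fun (d : List Bool) (i : ℕ) =>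
    ¬ d[i]? = some true ∨ E.Met (d.take i ++ [false])) h)
    (Computable.id.pair (Primrec.list_range.comp Primrec.list_length).to_comp)).of_eq fun d => ?_
  simp only [List.mem_range, id]
  constructor
  · rintro hd e ⟨t, rfl⟩
    simpa using hd e.length (by simp)
  · intro hd i hi
    rw [or_iff_not_imp_left, not_not]
    intro ht
    refine hd _ ?_
    rw [List.getElem?_eq_getElem hi, Option.some_inj] at ht
    rw [← ht, List.take_concat_get']
    exact List.take_prefix _ _

theorem adversary_isMonotone : IsMonotoneMachine E.adversary where
  re := rePred_and (rePred_comp E.released_re Computable.fst)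
    (rePred_of_primrecPred (Primrec.eq.comp Primrec.snd
      (Primrec.list_append.comp (primrec_blocks.comp Primrec.fst) (Primrec.const [false]))))
  compat := by
    rintro p y q x ⟨-, hy⟩ ⟨-, hx⟩ hpq
    simp only at hy hx
    exact Or.inl (hy ▸ hx ▸ blocks_concat_prefix hpq)

variable {E}

/-! ### The path of unmet demands -/

theorem released_nil : E.Released [] := by
  rintro e h
  simp at h

theorem released_concat {d : List Bool} {b : Bool} (hd : E.Released d)
    (hb : b = true → E.Met (d ++ [false])) : E.Released (d ++ [b]) := by
  intro e he
  rcases List.prefix_concat_iff.1 he with h | h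
  · obtain ⟨rfl, hb'⟩ := List.append_inj' h rfl
    exact hb (by simpa using hb'.symm)
  · exact hd e h

theorem not_met_nil : ¬ E.Met [] := by
  have h : E.M (blocks []) ≤ 1 := semimeasureOf_le_one _ _
  simp only [Met, List.length_nil, pow_zero, mul_one, not_lt, biasWeight, List.foldr_nil,
    Nat.cast_one]
  exact (add_le_add_left h 1).trans_eq one_add_one_eq_two

/-- The demands are superadditive: if they are met at both children of `d`, then at `d`. -/
theorem met_of_met_children {d : List Bool} (h0 : E.Met (d ++ [false])) (h1 : E.Met (d ++ [true])) :
    E.Met d := by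
  have hM : E.M (blocks (d ++ [false])) + E.M (blocks (d ++ [true])) ≤ E.M (blocks d) := by
    refine semimeasureOf_add_le E.universal_compat ?_ ?_ ?_ ?_ <;>
      simp [List.prefix_append_right_inj, blocks]
  have h4 : (4⁻¹ : ℝ≥0∞) = 2⁻¹ * 2⁻¹ := by
    rw [← ENNReal.mul_inv (by simp) (by simp)]
    norm_num
  have hbias : (biasWeight (d ++ [false]) : ℝ≥0∞) * 4⁻¹ ^ (d.length + 1) +
      biasWeight (d ++ [true]) * 4⁻¹ ^ (d.length + 1) = biasWeight d * 4⁻¹ ^ d.length := by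
    have h : (biasWeight (d ++ [false]) : ℝ≥0∞) + biasWeight (d ++ [true]) = biasWeight d * 4 := by
      rw [biasWeight_append, biasWeight_append]
      simp only [biasWeight]
      push_cast
      simp
      ring
    rw [← add_mul, h, pow_succ', mul_assoc, ← mul_assoc 4, ENNReal.mul_inv_cancel (by simp)
      (by simp), one_mul]
  have hhalf : (2 * 2⁻¹ ^ (d.length + 1) : ℝ≥0∞) + 2 * 2⁻¹ ^ (d.length + 1) =
      2 * 2⁻¹ ^ d.length := by
    rw [← mul_add, ← two_mul, pow_succ', ← mul_assoc 2 2⁻¹, ENNReal.mul_inv_cancel (by simp)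
      (by simp), one_mul]
  have h := ENNReal.add_lt_add h0 h1
  simp only [List.length_append, List.length_singleton] at h
  rw [hhalf, add_add_add_comm, hbias] at h
  exact h.trans_le (add_le_add_left hM _)

theorem biasWeight_le_of_not_met {d : List Bool} (h : ¬ E.Met d) :
    biasWeight d ≤ 2 * 2 ^ d.length := by
  by_contra hlt
  refine h (lt_of_lt_of_le ?_ le_add_self)
  have := (threshold_lt_iff d.length 0 0 (biasWeight d)).2 (by simpa using hlt)
  simpa using this

variable (E) in
open Classical in
/-- The program followed when the bit `1` is taken exactly if the demand at the sibling with the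
bit `0` is met, as the list of its first `n` bits. -/
noncomputable def pathPrefix : ℕ → List Bool
  | 0 => []
  | n + 1 => pathPrefix n ++ [decide (E.Met (pathPrefix n ++ [false]))]

variable (E) in
open Classical in
/-- The bits of the path whose initial segments are given by `pathPrefix`. -/
noncomputable def pathBit (n : ℕ) : Bool :=
  decide (E.Met (E.pathPrefix n ++ [false]))

theorem pathPrefix_succ (n : ℕ) : E.pathPrefix (n + 1) = E.pathPrefix n ++ [E.pathBit n] := rfl

theorem pathBit_eq_true {n : ℕ} : E.pathBit n = true ↔ E.Met (E.pathPrefix n ++ [false]) := by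
  simp [pathBit]

theorem length_pathPrefix (n : ℕ) : (E.pathPrefix n).length = n := by
  induction n with
  | zero => rfl
  | succ n ih => simp [pathPrefix_succ, ih]

theorem released_pathPrefix (n : ℕ) : E.Released (E.pathPrefix n) := by
  induction n with
  | zero => exact released_nil
  | succ n ih => exact released_concat ih pathBit_eq_true.1

theorem not_met_pathPrefix (n : ℕ) : ¬ E.Met (E.pathPrefix n) := by
  induction n with
  | zero => exact not_met_nil
  | succ n ih =>
    rw [pathPrefix_succ]
    rcases hb : E.pathBit n
    · exact fun h => by simp [pathBit_eq_true.2 h] at hb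
    · exact fun h => ih (met_of_met_children (pathBit_eq_true.1 hb) h)

/-- The path takes the bit `0` infinitely often: along a tail of ones the Bernoulli measure would
outgrow the uniform one, so that the demands would be met for free. -/
theorem exists_pathBit_eq_false (m : ℕ) : ∃ n ≥ m, E.pathBit n = false := by
  by_contra! hcon
  have hall : ∀ n ≥ m, E.pathBit n = true := fun n hn => by simpa using hcon n hn
  have hgrow : ∀ k, 3 ^ k ≤ biasWeight (E.pathPrefix (m + k)) := by
    intro k
    induction k with
    | zero =>
      have hpos : ∀ d : List Bool, 0 < biasWeight d := by
        intro d
        induction d with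
        | nil => simp [biasWeight]
        | cons c d ih =>
          simp only [biasWeight, List.foldr_cons] at ih ⊢
          split_ifs <;> omega
      simpa using Nat.one_le_iff_ne_zero.2 (hpos _).ne'
    | succ k ih =>
      rw [← add_assoc, pathPrefix_succ, hall _ (Nat.le_add_right m k), biasWeight_append, pow_succ]
      exact Nat.mul_le_mul ih (by simp [biasWeight])
  obtain ⟨k, hk⟩ := pow_unbounded_of_one_lt ((2 : ℝ) ^ (m + 1)) (show (1 : ℝ) < 3 / 2 by norm_num)
  have h1 := (hgrow k).trans (biasWeight_le_of_not_met (not_met_pathPrefix (m + k)))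
  rw [length_pathPrefix] at h1
  have h2 : (3 : ℝ) ^ k ≤ 2 * 2 ^ (m + k) := by exact_mod_cast h1
  rw [div_pow, lt_div_iff₀ (by positivity), ← pow_add] at hk
  rw [← pow_succ', show m + k + 1 = m + 1 + k by ring] at h2
  exact absurd h2 (not_le.2 hk)

/-! ### The loss of mass at forced bits -/

/-- While the demand at `d` followed by `0` is not met, the programs that extend `d` by `1` wait
after the first `0` of the next block, and the universal semimeasure loses their weight there. -/
theorem M_add_pow_le {i : ℕ} (hi : E.machine i = E.adversary) {d : List Bool}
    (hd : E.Released d) (h0 : ¬ E.Met (d ++ [false])) :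
    E.M (blocks d ++ [false] ++ [false]) + 2⁻¹ ^ ((E.code i).length + d.length + 1) ≤
      E.M (blocks d ++ [false]) := by
  have hlen : (E.code i ++ (d ++ [true])).length = (E.code i).length + d.length + 1 := by
    simp [add_assoc]
  rw [← hlen]
  refine semimeasureOf_add_pow_le (List.prefix_append _ _)
    ⟨E.code i ++ d, blocks d ++ [false], ⟨i, d, rfl, hi ▸ ⟨hd, rfl⟩⟩, ?_, List.prefix_rfl⟩ ?_
  · exact (List.prefix_append_right_inj _).2 (List.prefix_append _ _)
  rintro _ x ⟨j, q, rfl, hq⟩ hcomp hpre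
  have hij : i = j := by
    have : E.code j <+: E.code i ∨ E.code i <+: E.code j := by
      rcases hcomp with h | h
      · exact List.prefix_or_prefix_of_prefix ((List.prefix_append _ q).trans h)
          (List.prefix_append _ _)
      · exact List.prefix_or_prefix_of_prefix (List.prefix_append _ q)
          ((List.prefix_append _ _).trans h)
    rcases this with h | h
    · exact (E.prefixFree_code _ _ h).symm
    · exact E.prefixFree_code _ _ h
  subst hij
  rw [hi] at hq
  obtain ⟨hrel, hx⟩ := hq
  simp only at hrel hx
  rw [List.prefix_append_right_inj, List.prefix_append_right_inj] at hcomp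
  have hnot : ¬ d ++ [true] <+: q := fun h => h0 (hrel d h)
  rcases hcomp with h | h
  · rcases List.prefix_concat_iff.1 h with rfl | h
    · exact hnot List.prefix_rfl
    · have h1 := h.length_le
      have h2 := hpre.length_le
      rw [hx] at h2
      simp only [List.length_append, length_blocks, List.length_singleton] at h2
      omega
  · exact hnot h

variable (E) in
/-- The infinite string made of the blocks `0 0 c c` for the successive bits `c` of the path. -/
noncomputable def sequence (k : ℕ) : Bool :=
  if k % 4 < 2 then false else E.pathBit (k / 4)

theorem sequence_odd (n : ℕ) : E.sequence (2 * n + 1) = E.sequence (2 * n) := by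
  have h1 : (2 * n + 1) % 4 < 2 ↔ 2 * n % 4 < 2 := by omega
  have h2 : (2 * n + 1) / 4 = 2 * n / 4 := by omega
  simp only [sequence, h1, h2]

theorem initSeg_sequence (n : ℕ) : initSeg E.sequence (4 * n) = blocks (E.pathPrefix n) := by
  induction n with
  | zero => rfl
  | succ n ih =>
    have e0 : E.sequence (4 * n) = false := if_pos (by omega)
    have e1 : E.sequence (4 * n + 1) = false := if_pos (by omega)
    have e2 : E.sequence (4 * n + 2) = E.pathBit n := by
      rw [sequence, if_neg (by omega), show (4 * n + 2) / 4 = n by omega]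
    have e3 : E.sequence (4 * n + 3) = E.pathBit n := by
      rw [sequence, if_neg (by omega), show (4 * n + 3) / 4 = n by omega]
    rw [show 4 * (n + 1) = 4 * n + 1 + 1 + 1 + 1 by ring, initSeg_succ, initSeg_succ, initSeg_succ,
      initSeg_succ, ih, e0, e1, e2, e3, pathPrefix_succ, blocks_append]
    simp [blocks]

theorem copyLast_initSeg_odd (ω : ℕ → Bool) (n : ℕ) :
    copyLast (initSeg ω (2 * n + 1)) = some (ω (2 * n)) := by
  rw [copyLast, if_pos (by simp [length_initSeg]), initSeg_succ]
  simp

theorem condProb_le_of_pathBit_eq_false {i : ℕ} (hi : E.machine i = E.adversary) {n : ℕ}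
    (hn : E.pathBit n = false) :
    condProb E.M false (blocks (E.pathPrefix n) ++ [false]) ≤
      1 - 2⁻¹ ^ ((E.code i).length + 2) := by
  set d := E.pathPrefix n with hd
  set b := E.M (blocks d ++ [false]) with hb
  have h0 : ¬ E.Met (d ++ [false]) := fun h => by simp [pathBit_eq_true.2 h] at hn
  have hloss := M_add_pow_le hi (released_pathPrefix n) h0
  rw [← hd, ← hb] at hloss
  have hbound : b ≤ 2 * 2⁻¹ ^ d.length :=
    (semimeasureOf_anti _ (List.prefix_append _ _)).trans
      (le_self_add.trans (not_lt.1 (not_met_pathPrefix n)))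
  have hbtop : b ≠ ⊤ := ((semimeasureOf_le_one _ _).trans_lt ENNReal.one_lt_top).ne
  have hε : 2⁻¹ ^ ((E.code i).length + 2) * b ≤ 2⁻¹ ^ ((E.code i).length + d.length + 1) := by
    refine (mul_le_mul_right hbound _).trans_eq ?_
    calc (2⁻¹ ^ ((E.code i).length + 2) * (2 * 2⁻¹ ^ d.length) : ℝ≥0∞)
        = 2⁻¹ ^ ((E.code i).length + d.length + 1) * (2⁻¹ * 2) := by ring
      _ = _ := by rw [ENNReal.inv_mul_cancel (by simp) (by simp), mul_one]
  refine ENNReal.div_le_of_le_mul ?_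
  rw [ENNReal.sub_mul fun _ _ => hbtop, one_mul]
  refine ENNReal.le_sub_of_add_le_right ?_ ((add_le_add_right hε _).trans hloss)
  exact ENNReal.mul_ne_top (ENNReal.pow_ne_top (by simp)) hbtop

end MachineEnumeration

end SolomonoffInduction

open SolomonoffInduction in
/-- Bits are indexed from `0` here: `ω (2 * n)` and `ω (2 * n + 1)` are the odd and the even bit of
the `n`-th pair, and `initSeg ω (2 * n + 1)` is everything that precedes that even bit. -/
theorem mainTheorem3 :
    Computable copyLast ∧
    ∀ E : MachineEnumeration, ∃ ω : ℕ → Bool,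
      (∀ n : ℕ, copyLast (initSeg ω (2 * n + 1)) = some (ω (2 * n + 1)) ∧
        ω (2 * n + 1) = ω (2 * n)) ∧
      liminf (fun n : ℕ => condProb E.M (ω (2 * n + 1)) (initSeg ω (2 * n + 1))) atTop < 1 := by
  refine ⟨computable_copyLast, fun E => ⟨E.sequence, fun n => ⟨?_, E.sequence_odd n⟩, ?_⟩⟩
  · rw [MachineEnumeration.copyLast_initSeg_odd, E.sequence_odd]
  obtain ⟨i, hi⟩ := E.complete _ E.adversary_isMonotone
  have hlt : (1 - 2⁻¹ ^ ((E.code i).length + 2) : ℝ≥0∞) < 1 :=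
    ENNReal.sub_lt_self ENNReal.one_ne_top one_ne_zero (by simp)
  refine lt_of_le_of_lt (liminf_le_of_frequently_le' (frequently_atTop.2 fun m => ?_)) hlt
  obtain ⟨n, hn, hbit⟩ := MachineEnumeration.exists_pathBit_eq_false (E := E) m
  refine ⟨2 * n, by omega, ?_⟩
  have e0 : E.sequence (4 * n) = false := if_pos (by omega)
  have e1 : E.sequence (4 * n + 1) = false := if_pos (by omega)
  rw [show 2 * (2 * n) = 4 * n by ring, initSeg_succ, MachineEnumeration.initSeg_sequence, e0, e1]
  exact MachineEnumeration.condProb_le_of_pathBit_eq_false hi hbit
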